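/- A pseudometric on a set $X$ is a map $d\colon X\times X\to\mathbb R$ with $d(x,x)=0$, $d(x,y)=d(y,x)\ge 0$ and $d(x,y)+d(y,z)\ge d(x,z)$; it is a metric if $d(x,y)>0$ whenever $x\ne y$. A finite pseudometric space $X$ is *trim* if it has at most one point or if for every $x\in X$ there are points $y,z\in X$ such that $x,y,z$ are pairwise distinct and $d(x,y)+d(x,z)=d(y,z)$. **Trim core.** Let $(X,d)$ be a finite pseudometric space. For $x\in X$ put $\underline d(x)=0$ if $X=\{x\}$; $\underline d(x)=d(x,y)/2$ if $X=\{x,y\}$ has two points; and $$\underline d(x)=\inf\Big\{\tfrac12\big(d(x,y)+d(x,z)-d(y,z)\big) : y,z\in X\setminus\{x\},\ y\ne z\Big\}$$ if $X$ has at least three points. The formula $d^\bullet(x,x)=0$, $d^\bullet(x,y)=d(x,y)-\underline d(x)-\underline d(y)$ for $x\neq y$ defines a pseudometric on $X$; let $t(X)$ be the metric space obtained from $(X,d^\bullet)$ by identifying points at $d^\bullet$-distance $0$. For every finite $X$ there is an $n\ge 0$ such that $t^n(X)$ is a trim metric space (where $t^0(X)=X$). The *trim core* of $X$ is $c(X)=t^n(X)$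 for the least such $n$. **Metric forests.** A finite rooted tree $\tau$ is a finite tree with at least one edge, with a distinguished vertex $\ast$ (the root), whose edges are endowed with non-negative real lengths; $d_\tau(x,y)$ is the sum of the lengths of the edges of the shortest path between the vertices $x$ and $y$. A leaf of $\tau$ is a vertex of degree $1$ distinct from $\ast$. A finite metric forest $\zeta$ consists of a finite metric space $(B,d_B)$, called its base, and a family $(\zeta_a,\ast_a)_{a\in B}$ of finite rooted trees. Its leaf space is the disjoint union over $a\in B$ of the sets of leaves of $\zeta_a$, with the pseudometric defined, for leaves $x$ of $\zeta_a$ and $y$ of $\zeta_b$, by $$d_\zeta(x,y)=\begin{cases} d_{\zeta_a}(x,y) & \text{if } a=b,\\ d_{\zeta_a}(x,\ast_a)+d_B(a,b)+d_{\zeta_b}(y,\ast_b) & \text{if } a\ne b.\end{cases}$$ For a finite pseudometric space $X$ and a finite metric space $B$, write $X\ge B$ if there is a finite metric forest with base $B$ whose leaf space is isometric to $X$ (that is, there is a distance-preserving bijection between them). **Corollary.** If a finite pseudometric space $X$ and a trim finite metric space $B$ satisfy $X\ge B$, then $c(X)$ is isometric to $B$. -/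

import Mathlib

open scoped NNReal

universe u v w

namespace TrimCore

/-- `x` lies between `y` and `z`: the three points are pairwise distinct and
`d(x,y) + d(x,z) = d(y,z)`. -/
def Between {X : Type u} [PseudoMetricSpace X] (x y z : X) : Prop :=
  x ≠ y ∧ x ≠ z ∧ y ≠ z ∧ dist x y + dist x z = dist y z

/-- A finite pseudometric space is trim if it has at most one point or each of its points lies
between two other points. -/
def IsTrim (X : Type u) [PseudoMetricSpace X] : Prop :=
  Subsingleton X ∨ ∀ x : X, ∃ y z : X, Between x y z

/-- The pseudometric of `X` is a metric. -/
def IsMetric (X : Type u) [PseudoMetricSpace X] : Prop :=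
  ∀ x y : X, x ≠ y → 0 < dist x y

/-- Finite pseudometric spaces. -/
structure FinPMet : Type (u + 1) where
  carrier : Type u
  [finite : Finite carrier]
  [pseudoMetric : PseudoMetricSpace carrier]

instance : CoeSort FinPMet.{u} (Type u) := ⟨FinPMet.carrier⟩

instance (X : FinPMet.{u}) : Finite X := X.finite

instance (X : FinPMet.{u}) : PseudoMetricSpace X := X.pseudoMetric

/-- The real number `d(x,y,z) = (d(x,y) + d(x,z) - d(y,z)) / 2`. -/
noncomputable def tripleDist {X : Type u} [PseudoMetricSpace X] (x y z : X) : ℝ :=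
  (dist x y + dist x z - dist y z) / 2

open Classical in
/-- The function `\underline d`: if `X` has at least three points, the infimum of `d(x,y,z)` over
all distinct `y, z ∈ X \ {x}`; if `X` has two points, half of the distance from `x` to the other
point; if `x` is the only point, zero. -/
noncomputable def gap (X : FinPMet.{u}) (x : X) : ℝ :=
  if 3 ≤ Nat.card X then
    sInf {r : ℝ | ∃ y z : X, y ≠ x ∧ z ≠ x ∧ y ≠ z ∧ r = tripleDist x y z}
  else if h : ∃ y : X, y ≠ x then dist x h.choose / 2
  else 0

theorem tripleDist_nonneg {X : Type u} [PseudoMetricSpace X] (x y z : X) :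
    0 ≤ tripleDist x y z := by
  have := dist_triangle_left y z x
  unfold tripleDist
  linarith

theorem gap_le (X : FinPMet.{u}) (x y z : X) (hy : y ≠ x) (hz : z ≠ x) (hyz : y ≠ z) :
    gap X x ≤ tripleDist x y z := by
  have h3 : 3 ≤ Nat.card X := by
    have := Fintype.ofFinite X
    rw [Nat.card_eq_fintype_card]
    exact Fintype.two_lt_card_iff.2 ⟨x, y, z, hy.symm, hz.symm, hyz⟩
  rw [gap, if_pos h3]
  refine csInf_le ⟨0, ?_⟩ ⟨y, z, hy, hz, hyz, rfl⟩
  rintro r ⟨y, z, -, -, -, rfl⟩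
  exact tripleDist_nonneg _ _ _

theorem gap_of_two (X : FinPMet.{u}) (h3 : ¬ 3 ≤ Nat.card X) (x y : X) (hxy : x ≠ y) :
    gap X x = dist x y / 2 := by
  have h : ∃ y : X, y ≠ x := ⟨y, hxy.symm⟩
  rw [gap, if_neg h3, dif_pos h]
  have hc : h.choose = y := by
    by_contra hne
    apply h3
    have := Fintype.ofFinite X
    rw [Nat.card_eq_fintype_card]
    exact Fintype.two_lt_card_iff.2 ⟨x, y, h.choose, hxy, h.choose_spec.symm, Ne.symm hne⟩
  rw [hc]

theorem exists_third (X : FinPMet.{u}) (h3 : 3 ≤ Nat.card X) (x y : X) :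
    ∃ z : X, z ≠ x ∧ z ≠ y := by
  classical
  have := Fintype.ofFinite X
  rw [Nat.card_eq_fintype_card] at h3
  obtain ⟨z, -, hz⟩ := Finset.exists_mem_notMem_of_card_lt_card
    (s := {x, y}) (t := (Finset.univ : Finset X))
    (lt_of_le_of_lt Finset.card_le_two (by rw [Finset.card_univ]; omega))
  refine ⟨z, ?_, ?_⟩ <;> rintro rfl <;> simp at hz

theorem exists_gap_eq (X : FinPMet.{u}) (h3 : 3 ≤ Nat.card X) (x : X) :
    ∃ y z : X, y ≠ x ∧ z ≠ x ∧ y ≠ z ∧ gap X x = tripleDist x y z := by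
  have key : gap X x ∈ {r : ℝ | ∃ y z : X, y ≠ x ∧ z ≠ x ∧ y ≠ z ∧ r = tripleDist x y z} := by
    rw [gap, if_pos h3]
    apply Set.Nonempty.csInf_mem
    · obtain ⟨y, hy, -⟩ := exists_third X h3 x x
      obtain ⟨z, hz, hzy⟩ := exists_third X h3 x y
      exact ⟨_, y, z, hy, hz, hzy.symm, rfl⟩
    · refine (Set.finite_range fun p : X × X => tripleDist x p.1 p.2).subset ?_
      rintro r ⟨y, z, -, -, -, rfl⟩
      exact ⟨(y, z), rfl⟩
  exact key

theorem gap_add_gap_le (X : FinPMet.{u}) (x y : X) (hxy : x ≠ y) :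
    gap X x + gap X y ≤ dist x y := by
  by_cases h3 : 3 ≤ Nat.card X
  · obtain ⟨z, hzx, hzy⟩ := exists_third X h3 x y
    have h1 := gap_le X x y z hxy.symm hzx hzy.symm
    have h2 := gap_le X y x z hxy hzy hzx.symm
    have := dist_comm x y
    unfold tripleDist at h1 h2
    linarith
  · rw [gap_of_two X h3 x y hxy, gap_of_two X h3 y x hxy.symm, dist_comm y x]
    linarith

open Classical in
/-- The function `d^•`: it is `0` on the diagonal, and
`d^•(x,y) = d(x,y) - \underline d(x) - \underline d(y)` for `x ≠ y`. -/
noncomputable def bulletDist (X : FinPMet.{u}) (x y : X) : ℝ :=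
  if x = y then 0 else dist x y - gap X x - gap X y

/-- The pseudometric space `(X, d^•)`, with the same points as `X`. -/
noncomputable def bullet (X : FinPMet.{u}) : FinPMet.{u} where
  carrier := X.carrier
  finite := X.finite
  pseudoMetric :=
    { dist := bulletDist X
      dist_self := fun x => by simp [bulletDist]
      dist_comm := fun x y => by
        by_cases h : x = y
        · rw [h]
        · simp only [bulletDist, if_neg h, if_neg (Ne.symm h), dist_comm x y]
          ring
      dist_triangle := fun x y z => by
        by_cases hxy : x = y
        · subst hxy
          simp [bulletDist]
        by_cases hyz : y = z
        · subst hyz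
          simp [bulletDist]
        by_cases hxz : x = z
        · subst hxz
          have := gap_add_gap_le X x y hxy
          have := dist_comm x y
          simp only [bulletDist, if_neg hxy, if_neg hyz, if_true]
          linarith
        · have h := gap_le X y x z hxy (Ne.symm hyz) hxz
          have := dist_comm x y
          simp only [bulletDist, if_neg hxy, if_neg hyz, if_neg hxz]
          unfold tripleDist at h
          linarith }

/-- The trimming `t(X)`: the metric quotient of `(X, d^•)`, where points at distance `0` are
identified. -/
noncomputable def trimming (X : FinPMet.{u}) : FinPMet.{u} where
  carrier := SeparationQuotient (bullet X)
  finite := Finite.of_surjective _ SeparationQuotient.surjective_mk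
  pseudoMetric := inferInstanceAs (PseudoMetricSpace (SeparationQuotient (bullet X)))

/-- The projection `p_X : X → t(X)`. -/
noncomputable def proj (X : FinPMet.{u}) (x : X) : trimming X :=
  SeparationQuotient.mk (X := bullet X) x

theorem proj_surjective (X : FinPMet.{u}) : Function.Surjective (proj X) :=
  SeparationQuotient.surjective_mk (X := bullet X)

theorem dist_proj (X : FinPMet.{u}) (x y : X) :
    dist (proj X x) (proj X y) = bulletDist X x y :=
  SeparationQuotient.dist_mk (α := bullet X) x y

theorem isMetric_trimming (X : FinPMet.{u}) : IsMetric (trimming X) := fun x y hxy =>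
  @dist_pos (SeparationQuotient (bullet X)) _ x y |>.2 hxy

theorem isTrim_trimming (X : FinPMet.{u}) (hX : Function.Injective (proj X)) :
    IsTrim (trimming X) := by
  by_cases h3 : 3 ≤ Nat.card X
  · right
    intro a
    obtain ⟨x, rfl⟩ := proj_surjective X a
    obtain ⟨y, z, hy, hz, hyz, h⟩ := exists_gap_eq X h3 x
    refine ⟨proj X y, proj X z, hX.ne hy.symm, hX.ne hz.symm, hX.ne hyz, ?_⟩
    simp only [dist_proj, bulletDist, if_neg hy.symm, if_neg hz.symm, if_neg hyz]
    unfold tripleDist at h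
    linarith
  · left
    refine ⟨fun a b => ?_⟩
    obtain ⟨x, rfl⟩ := proj_surjective X a
    obtain ⟨y, rfl⟩ := proj_surjective X b
    by_contra hne
    have hxy : x ≠ y := fun h => hne (h ▸ rfl)
    have hpos := isMetric_trimming X _ _ hne
    rw [dist_proj, bulletDist, if_neg hxy, gap_of_two X h3 x y hxy,
      gap_of_two X h3 y x hxy.symm, dist_comm y x] at hpos
    linarith

/-- Every finite pseudometric space has finite height: some iterated trimming is a trim metric
space. -/
theorem exists_height (X : FinPMet.{u}) :
    ∃ n : ℕ, IsMetric (trimming^[n] X) ∧ IsTrim (trimming^[n] X) := by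
  induction hN : Nat.card X using Nat.strong_induction_on generalizing X with
  | _ N ih =>
    by_cases hX : Function.Injective (proj X)
    · exact ⟨1, isMetric_trimming X, isTrim_trimming X hX⟩
    · have hlt : Nat.card (trimming X) < N := by
        rw [← hN]
        refine lt_of_le_of_ne (Nat.card_le_card_of_surjective _ (proj_surjective X)) fun he => ?_
        exact hX ((Nat.bijective_iff_surjective_and_card _).2
          ⟨proj_surjective X, he.symm⟩).injective
      obtain ⟨n, hn⟩ := ih _ hlt (trimming X) rfl
      exact ⟨n + 1, hn⟩

open Classical in
/-- The height of `X`: the least `n` such that `t^n(X)` is a trim metric space. -/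
noncomputable def height (X : FinPMet.{u}) : ℕ := Nat.find (exists_height X)

/-- The trim core `c(X) = t^n(X)`, where `n` is the height of `X`. -/
noncomputable def trimCore (X : FinPMet.{u}) : FinPMet.{u} := trimming^[height X] X

/-- A rooted metric tree with at least one edge. Only the values of `len` at edges matter. -/
structure RootedMetricTree : Type (w + 1) where
  V : Type w
  graph : SimpleGraph V
  isTree : graph.IsTree
  exists_edge : graph.edgeSet.Nonempty
  len : Sym2 V → ℝ≥0
  root : V

namespace RootedMetricTree

/-- The path pseudometric: the sum of the lengths of the edges of the unique injective path from
`x` to `y`. -/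
noncomputable def pathDist (τ : RootedMetricTree.{w}) (x y : τ.V) : ℝ :=
  (((τ.isTree.existsUnique_path x y).choose.edges.map fun e => (τ.len e : ℝ))).sum

/-- A leaf is a vertex of degree `1` distinct from the root. -/
def IsLeaf (τ : RootedMetricTree.{w}) (x : τ.V) : Prop :=
  x ≠ τ.root ∧ (τ.graph.neighborSet x).ncard = 1

/-- The set of leaves of a rooted tree. -/
def Leaf (τ : RootedMetricTree.{w}) : Type w := {x : τ.V // τ.IsLeaf x}

end RootedMetricTree

/-- A metric forest with base the metric space `B`: a family of rooted trees indexed by `B`. -/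
structure MetricForest (B : Type v) [MetricSpace B] : Type (max v (w + 1)) where
  component : B → RootedMetricTree.{w}

namespace MetricForest

variable {B : Type v} [MetricSpace B]

/-- A forest is finite if its base is finite and its components are finite trees. -/
def IsFinite (ζ : MetricForest.{v, w} B) : Prop :=
  Finite B ∧ ∀ a, Finite (ζ.component a).V

/-- The leaves of a forest: the disjoint union of the leaves of its components. -/
def Leaf (ζ : MetricForest.{v, w} B) : Type (max v w) := Σ a : B, (ζ.component a).Leaf

open Classical in
/-- The distance on the leaves of a forest: the path pseudometric within one component, and
`d(x, *_a) + d_B(a, b) + d(y, *_b)` for leaves `x`, `y` of different components `a`, `b`. -/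
noncomputable def leafDist (ζ : MetricForest.{v, w} B) : ζ.Leaf → ζ.Leaf → ℝ
  | ⟨a, x⟩, ⟨b, y⟩ =>
    if h : a = b then (ζ.component b).pathDist (h ▸ x).1 y.1
    else (ζ.component a).pathDist x.1 (ζ.component a).root + dist a b
      + (ζ.component b).pathDist y.1 (ζ.component b).root

end MetricForest

/-- `X ≥ B`: some finite metric forest has base `B` and leaf space (isometric to) `X`. -/
def Dominates (X : Type u) [PseudoMetricSpace X] (B : Type v) [MetricSpace B] : Prop :=
  ∃ ζ : MetricForest.{v, w} B, ζ.IsFinite ∧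
    ∃ e : X ≃ ζ.Leaf, ∀ x y : X, dist x y = ζ.leafDist (e x) (e y)

end TrimCore

/-! Gromov products at the roots, set to 0 across different trees, give a kernel `k` on the leaves
with `d(x,y) = k(x,x) + k(y,y) - 2k(x,y) + d_B(πx,πy)`. It is non-negative and ultrametric, and it
vanishes between different fibres of the projection `π` onto `B`
(`Dominates.nonempty_forestKernel`).

If `B` is trim with more than one point, trimming preserves this shape: only the diagonal of `k`
drops, by the gap, and the bound `gap x + k(x,y) ≤ k(x,x)` (`gap_add_kernel_le`) keeps it
ultrametric. So the trim core carries such a kernel. On a trim metric space the kernel is zero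
(`kernel_eq_zero_of_isTrim`), hence `π` is an isometry.

If `B` has at most one point, the gap bound fails for want of a second tree. Instead `d` satisfies
the four-point condition, which survives trimming and leaves at most one point in a trim metric
space. -/

namespace TrimCore

/-! ### Paths, medians and Gromov products in rooted trees. -/

namespace RootedMetricTree

variable (τ : RootedMetricTree.{w})

/-- The sum of the lengths of the edges of a walk. -/
noncomputable def walkLen {x y : τ.V} (p : τ.graph.Walk x y) : ℝ :=
  (p.edges.map fun e => (τ.len e : ℝ)).sum

theorem walkLen_nonneg {x y : τ.V} (p : τ.graph.Walk x y) : 0 ≤ τ.walkLen p := by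
  apply List.sum_nonneg
  simp only [List.mem_map]
  rintro _ ⟨e, -, rfl⟩
  exact (τ.len e).coe_nonneg

theorem walkLen_append {x y z : τ.V} (p : τ.graph.Walk x y) (q : τ.graph.Walk y z) :
    τ.walkLen (p.append q) = τ.walkLen p + τ.walkLen q := by
  simp [walkLen, SimpleGraph.Walk.edges_append]

theorem walkLen_reverse {x y : τ.V} (p : τ.graph.Walk x y) :
    τ.walkLen p.reverse = τ.walkLen p := by
  simp [walkLen, SimpleGraph.Walk.edges_reverse, List.map_reverse, List.sum_reverse]

theorem path_eq {x y : τ.V} {p q : τ.graph.Walk x y} (hp : p.IsPath) (hq : q.IsPath) : p = q :=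
  (τ.isTree.existsUnique_path x y).unique hp hq

theorem pathDist_eq {x y : τ.V} {p : τ.graph.Walk x y} (hp : p.IsPath) :
    τ.pathDist x y = τ.walkLen p := by
  rw [← τ.path_eq (τ.isTree.existsUnique_path x y).choose_spec.1 hp]
  rfl

theorem pathDist_nonneg (x y : τ.V) : 0 ≤ τ.pathDist x y :=
  τ.walkLen_nonneg _

theorem pathDist_self (x : τ.V) : τ.pathDist x x = 0 := by
  rw [τ.pathDist_eq (SimpleGraph.Walk.IsPath.nil (u := x))]
  simp [walkLen]

theorem pathDist_comm (x y : τ.V) : τ.pathDist x y = τ.pathDist y x := by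
  obtain ⟨p, hp, -⟩ := τ.isTree.existsUnique_path x y
  rw [τ.pathDist_eq hp, τ.pathDist_eq hp.reverse, walkLen_reverse]

/-- The vertex `m` lies on the path from `x` to `y`. -/
def OnPath (x m y : τ.V) : Prop :=
  ∃ (p : τ.graph.Walk x m) (q : τ.graph.Walk m y), (p.append q).IsPath

variable {τ}

theorem OnPath.symm {x m y : τ.V} (h : τ.OnPath x m y) : τ.OnPath y m x := by
  obtain ⟨p, q, h⟩ := h
  refine ⟨q.reverse, p.reverse, ?_⟩
  rw [← SimpleGraph.Walk.reverse_append]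
  exact h.reverse

theorem OnPath.pathDist_add {x m y : τ.V} (h : τ.OnPath x m y) :
    τ.pathDist x y = τ.pathDist x m + τ.pathDist m y := by
  obtain ⟨p, q, h⟩ := h
  rw [τ.pathDist_eq h, τ.pathDist_eq h.of_append_left, τ.pathDist_eq h.of_append_right,
    walkLen_append]

theorem OnPath.trans {r u v x : τ.V} (huv : τ.OnPath r u v) (hvx : τ.OnPath r v x) :
    τ.OnPath r u x := by
  obtain ⟨a, b, hab⟩ := huv
  obtain ⟨c, d, hcd⟩ := hvx
  obtain rfl := τ.path_eq hab hcd.of_append_left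
  exact ⟨a, b.append d, by rwa [SimpleGraph.Walk.append_assoc]⟩

/-- Paths are unique, so `u` and `v` lie on one path and one precedes the other. -/
theorem OnPath.total {r u v x : τ.V} (hu : τ.OnPath r u x) (hv : τ.OnPath r v x) :
    τ.OnPath r u v ∨ τ.OnPath r v u := by
  classical
  obtain ⟨a, b, hab⟩ := hu
  obtain ⟨c, d, hcd⟩ := hv
  have hmem : v ∈ (a.append b).support := by
    rw [τ.path_eq hab hcd]
    simp
  rcases SimpleGraph.Walk.mem_support_append_iff _ _ |>.1 hmem with h | h
  · right
    refine ⟨a.takeUntil v h, a.dropUntil v h, ?_⟩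
    rw [SimpleGraph.Walk.take_spec]
    exact hab.of_append_left
  · left
    refine ⟨a, b.takeUntil v h, ?_⟩
    rw [← b.take_spec h, SimpleGraph.Walk.append_assoc] at hab
    exact hab.of_append_left

/-- A walk that ends in a set splits at its first vertex in the set. -/
theorem exists_split {V : Type*} {G : SimpleGraph V} (S : Set V) {y r : V} (q : G.Walk y r)
    (hr : r ∈ S) :
    ∃ (m : V) (q₁ : G.Walk y m) (q₂ : G.Walk m r), m ∈ S ∧ q₁.append q₂ = q ∧
      ∀ v ∈ q₁.support, v ∈ S → v = m := by
  induction q with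
  | nil => exact ⟨_, .nil, .nil, hr, rfl, by simp⟩
  | @cons u v r h q ih =>
    by_cases hu : u ∈ S
    · exact ⟨u, .nil, .cons h q, hu, rfl, by simp⟩
    · obtain ⟨m, q₁, q₂, hm, hq, hq₁⟩ := ih hr
      refine ⟨m, .cons h q₁, q₂, hm, by simp [hq], ?_⟩
      intro v hv hvS
      rw [SimpleGraph.Walk.support_cons, List.mem_cons] at hv
      rcases hv with rfl | hv
      · exact absurd hvS hu
      · exact hq₁ v hv hvS

theorem isPath_append {V : Type*} {G : SimpleGraph V} {x y z : V} {p : G.Walk x y}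
    {q : G.Walk y z} (hp : p.IsPath) (hq : q.IsPath)
    (h : ∀ v ∈ p.support, v ∈ q.support → v = y) : (p.append q).IsPath := by
  induction p with
  | nil => exact hq
  | @cons a b c hadj p ih =>
    rw [SimpleGraph.Walk.cons_isPath_iff] at hp
    rw [SimpleGraph.Walk.cons_append, SimpleGraph.Walk.cons_isPath_iff]
    refine ⟨ih hp.1 hq fun v hv => h v (by simp [hv]), fun hmem => ?_⟩
    rcases SimpleGraph.Walk.mem_support_append_iff _ _ |>.1 hmem with h1 | h1
    · exact hp.2 h1
    · have : a = c := h a (by simp) h1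
      subst this
      exact hp.2 p.end_mem_support

variable (τ)

/-- Three vertices of a tree have a median. -/
theorem exists_median (x y z : τ.V) :
    ∃ m : τ.V, τ.OnPath z m x ∧ τ.OnPath z m y ∧ τ.OnPath x m y := by
  classical
  obtain ⟨p, hp, -⟩ := τ.isTree.existsUnique_path z x
  obtain ⟨q, hq, -⟩ := τ.isTree.existsUnique_path y z
  -- The median is the first vertex at which the path from `y` to `z` meets the path from `z` to
  -- `x`.
  obtain ⟨m, q₁, q₂, hm, rfl, hq₁⟩ := exists_split {v | v ∈ p.support} q p.start_mem_support
  refine ⟨m, ⟨p.takeUntil m hm, p.dropUntil m hm, by rwa [SimpleGraph.Walk.take_spec]⟩,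
    OnPath.symm ⟨q₁, q₂, hq⟩, OnPath.symm ⟨q₁, p.dropUntil m hm, ?_⟩⟩
  exact isPath_append hq.of_append_left (hp.dropUntil hm) fun v hv hv' =>
    hq₁ v hv (p.support_dropUntil_subset_support hm hv')

theorem pathDist_triangle (x y z : τ.V) :
    τ.pathDist x z ≤ τ.pathDist x y + τ.pathDist y z := by
  obtain ⟨m, h1, h2, h3⟩ := τ.exists_median x z y
  rw [h3.pathDist_add, τ.pathDist_comm x y, h1.pathDist_add, h2.pathDist_add,
    τ.pathDist_comm x m]
  linarith [τ.pathDist_nonneg y m]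

/-- The Gromov product of two vertices with respect to the root. -/
noncomputable def gromov (x y : τ.V) : ℝ :=
  (τ.pathDist τ.root x + τ.pathDist τ.root y - τ.pathDist x y) / 2

theorem gromov_comm (x y : τ.V) : τ.gromov x y = τ.gromov y x := by
  rw [gromov, gromov, τ.pathDist_comm x y]
  ring

theorem gromov_self (x : τ.V) : τ.gromov x x = τ.pathDist τ.root x := by
  rw [gromov, pathDist_self]
  ring

theorem gromov_nonneg (x y : τ.V) : 0 ≤ τ.gromov x y := by
  have := τ.pathDist_triangle x τ.root y
  rw [τ.pathDist_comm x τ.root] at this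
  unfold gromov
  linarith

theorem pathDist_le_gromov {m x y : τ.V} (hx : τ.OnPath τ.root m x)
    (hy : τ.OnPath τ.root m y) : τ.pathDist τ.root m ≤ τ.gromov x y := by
  have := τ.pathDist_triangle x m y
  rw [τ.pathDist_comm x m] at this
  rw [gromov, hx.pathDist_add, hy.pathDist_add]
  linarith

theorem exists_gromov_eq (x y : τ.V) :
    ∃ m : τ.V, τ.OnPath τ.root m x ∧ τ.OnPath τ.root m y ∧
      τ.gromov x y = τ.pathDist τ.root m := by
  obtain ⟨m, h1, h2, h3⟩ := τ.exists_median x y τ.root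
  refine ⟨m, h1, h2, ?_⟩
  rw [gromov, h1.pathDist_add, h2.pathDist_add, h3.pathDist_add, τ.pathDist_comm x m]
  ring

/-- The branch points of `x, z` and of `z, y` both lie on the path from the root to `z`, hence are
comparable; the one nearer the root is a common ancestor of `x` and `y`. -/
theorem min_gromov_le (x y z : τ.V) : min (τ.gromov x z) (τ.gromov z y) ≤ τ.gromov x y := by
  obtain ⟨m, hmx, hmz, hm⟩ := τ.exists_gromov_eq x z
  obtain ⟨n, hnz, hny, hn⟩ := τ.exists_gromov_eq z y
  rw [hm, hn]
  rcases hmz.total hnz with h | h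
  · exact (min_le_left _ _).trans (τ.pathDist_le_gromov hmx (h.trans hny))
  · exact (min_le_right _ _).trans (τ.pathDist_le_gromov (h.trans hmx) hny)

/-- There are two vertices of degree one, and at most one is the root. This makes the projection
from the leaves to the base surjective. -/
theorem exists_isLeaf [Finite τ.V] : ∃ x, τ.IsLeaf x := by
  classical
  have := Fintype.ofFinite τ.V
  have : Nontrivial τ.V := by
    obtain ⟨e, he⟩ := τ.exists_edge
    induction e with
    | _ a b => exact ⟨a, b, SimpleGraph.Adj.ne he⟩
  have key (x : τ.V) (hx : τ.graph.degree x = 1) : (τ.graph.neighborSet x).ncard = 1 := by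
    rw [← hx, Set.ncard_eq_toFinset_card', ← SimpleGraph.card_neighborFinset_eq_degree]
    rfl
  obtain ⟨u, v, huv, hu, hv⟩ := τ.isTree.exists_ne_and_degree_eq_one
  by_cases h : u = τ.root
  · exact ⟨v, fun hv' => huv (h.trans hv'.symm), key v hv⟩
  · exact ⟨u, h, key u hu⟩

end RootedMetricTree

/-! ### The kernel of a metric forest. -/

/-- A presentation of the pseudometric of `X` by a metric on `B`, a projection `X → B` and an
ultrametric kernel supported on the fibres of the projection. -/
structure ForestKernel (X : Type u) [PseudoMetricSpace X] (B : Type v) [MetricSpace B] where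
  base : X → B
  kernel : X → X → ℝ
  base_surjective : Function.Surjective base
  nonneg : ∀ x y, 0 ≤ kernel x y
  comm : ∀ x y, kernel x y = kernel y x
  ultra : ∀ x y z, min (kernel x z) (kernel z y) ≤ kernel x y
  eq_zero : ∀ x y, base x ≠ base y → kernel x y = 0
  dist_eq : ∀ x y, dist x y = kernel x x + kernel y y - 2 * kernel x y + dist (base x) (base y)

namespace MetricForest

variable {B : Type v} [MetricSpace B]

open Classical in
/-- The Gromov product of leaves of a forest; it is zero for leaves of different components. -/
noncomputable def gromov (ζ : MetricForest.{v, w} B) : ζ.Leaf → ζ.Leaf → ℝ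
  | ⟨a, x⟩, ⟨b, y⟩ => if h : a = b then (ζ.component b).gromov (h ▸ x).1 y.1 else 0

variable (ζ : MetricForest.{v, w} B)

theorem gromov_of_eq (a : B) (x y : (ζ.component a).Leaf) :
    ζ.gromov ⟨a, x⟩ ⟨a, y⟩ = (ζ.component a).gromov x.1 y.1 := by
  simp [gromov]

theorem gromov_of_ne {a b : B} (h : a ≠ b) (x : (ζ.component a).Leaf)
    (y : (ζ.component b).Leaf) : ζ.gromov ⟨a, x⟩ ⟨b, y⟩ = 0 := by
  simp [gromov, h]

theorem gromov_nonneg : ∀ x y : ζ.Leaf, 0 ≤ ζ.gromov x y := by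
  rintro ⟨a, x⟩ ⟨b, y⟩
  by_cases h : a = b
  · subst h
    rw [gromov_of_eq]
    exact RootedMetricTree.gromov_nonneg _ _ _
  · rw [ζ.gromov_of_ne h]

theorem gromov_comm : ∀ x y : ζ.Leaf, ζ.gromov x y = ζ.gromov y x := by
  rintro ⟨a, x⟩ ⟨b, y⟩
  by_cases h : a = b
  · subst h
    rw [gromov_of_eq, gromov_of_eq, RootedMetricTree.gromov_comm]
  · rw [ζ.gromov_of_ne h, ζ.gromov_of_ne (Ne.symm h)]

theorem min_gromov_le :
    ∀ x y z : ζ.Leaf, min (ζ.gromov x z) (ζ.gromov z y) ≤ ζ.gromov x y := by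
  rintro ⟨a, x⟩ ⟨b, y⟩ ⟨c, z⟩
  by_cases hac : a = c
  · subst hac
    by_cases hab : a = b
    · subst hab
      simp only [gromov_of_eq]
      exact RootedMetricTree.min_gromov_le _ _ _ _
    · rw [ζ.gromov_of_ne hab, ζ.gromov_of_ne hab]
      exact min_le_right _ _
  · rw [ζ.gromov_of_ne hac]
    exact (min_le_left _ _).trans (ζ.gromov_nonneg _ _)

theorem leafDist_eq : ∀ x y : ζ.Leaf,
    ζ.leafDist x y = ζ.gromov x x + ζ.gromov y y - 2 * ζ.gromov x y + dist x.1 y.1 := by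
  rintro ⟨a, x⟩ ⟨b, y⟩
  rw [gromov_of_eq, gromov_of_eq, RootedMetricTree.gromov_self, RootedMetricTree.gromov_self]
  by_cases h : a = b
  · subst h
    rw [gromov_of_eq]
    simp only [leafDist, dist_self, RootedMetricTree.gromov, dite_true]
    ring
  · rw [ζ.gromov_of_ne h]
    simp only [leafDist, dif_neg h]
    rw [RootedMetricTree.pathDist_comm _ x.1, RootedMetricTree.pathDist_comm _ y.1]
    ring

end MetricForest

theorem Dominates.nonempty_forestKernel {X : Type u} [PseudoMetricSpace X] {B : Type v}
    [MetricSpace B] (h : Dominates.{u, v, w} X B) : Nonempty (ForestKernel X B) := by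
  obtain ⟨ζ, ⟨-, hfin⟩, e, he⟩ := h
  refine ⟨⟨fun x => (e x).1, fun x y => ζ.gromov (e x) (e y), fun b => ?_,
    fun _ _ => ζ.gromov_nonneg _ _, fun _ _ => ζ.gromov_comm _ _,
    fun _ _ _ => ζ.min_gromov_le _ _ _, fun x y hxy => ζ.gromov_of_ne hxy _ _,
    fun x y => (he x y).trans (ζ.leafDist_eq _ _)⟩⟩
  have := hfin b
  obtain ⟨x, hx⟩ := (ζ.component b).exists_isLeaf
  exact ⟨e.symm ⟨b, x, hx⟩, congrArg Sigma.fst (e.apply_symm_apply _)⟩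

end TrimCore

namespace TrimCore

/-! ### Kernels on trim metric spaces vanish. -/

namespace ForestKernel

section

variable {X : Type u} [PseudoMetricSpace X] {B : Type v} [MetricSpace B] (k : ForestKernel X B)

theorem kernel_le_self (x y : X) : k.kernel x y ≤ k.kernel x x := by
  have := k.ultra x x y
  rwa [k.comm y x, min_self] at this

theorem tripleDist_eq (x y z : X) :
    tripleDist x y z = k.kernel x x - k.kernel x y - k.kernel x z + k.kernel y z
      + tripleDist (k.base x) (k.base y) (k.base z) := by
  simp only [tripleDist, k.dist_eq]
  ring

/-- If `x` lies between `y` and `z`, then `x` sits below `y` or below `z`. -/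
theorem exists_kernel_eq_self (hX : ∀ x : X, ∃ y z : X, Between x y z) (x : X) :
    ∃ y, y ≠ x ∧ k.kernel x y = k.kernel x x := by
  obtain ⟨y, z, hxy, hxz, -, h⟩ := hX x
  have h0 : tripleDist x y z = 0 := by
    unfold tripleDist
    linarith
  rw [k.tripleDist_eq] at h0
  have h1 := tripleDist_nonneg (k.base x) (k.base y) (k.base z)
  have h2 := k.ultra y z x
  rw [k.comm y x] at h2
  -- Since `k(y,z)` is at least the smaller of `k(x,y)` and `k(x,z)`, the equation `h0` forces
  -- `k(x,x)` to be at most the larger one.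
  rcases min_choice (k.kernel x y) (k.kernel x z) with hm | hm
  · exact ⟨z, hxz.symm, le_antisymm (k.kernel_le_self x z) (by linarith)⟩
  · exact ⟨y, hxy.symm, le_antisymm (k.kernel_le_self x y) (by linarith)⟩

/-- Take `m` with `k(m,m)` maximal and `z ≠ m` with `k(m,z) = k(m,m)`. If this value is nonzero, `m`
and `z` share a fibre, so `d(m,z) = k(z,z) - k(m,m) ≤ 0`, contradicting that `X` is metric. -/
theorem kernel_eq_zero_of_isTrim [Finite X] (hmet : IsMetric X)
    (hX : ∀ x : X, ∃ y z : X, Between x y z) (x y : X) : k.kernel x y = 0 := by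
  have : Nonempty X := ⟨x⟩
  obtain ⟨m, hm⟩ := Finite.exists_max fun x => k.kernel x x
  suffices h : k.kernel m m = 0 from
    le_antisymm ((k.kernel_le_self x y).trans ((hm x).trans h.le)) (k.nonneg x y)
  by_contra hne
  obtain ⟨z, hz, hmz⟩ := k.exists_kernel_eq_self hX m
  have hbase : k.base m = k.base z := by
    by_contra hb
    exact hne (hmz ▸ k.eq_zero m z hb)
  have hpos := hmet m z hz.symm
  rw [k.dist_eq, hbase, dist_self] at hpos
  linarith [hm z]

theorem nonempty_isometryEquiv {X : Type u} [PseudoMetricSpace X] [Finite X]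
    (k : ForestKernel X B) (hmet : IsMetric X)
    (hX : ∀ x : X, ∃ y z : X, Between x y z) : Nonempty (X ≃ᵢ B) := by
  have hd (x y : X) : dist (k.base x) (k.base y) = dist x y := by
    rw [k.dist_eq, k.kernel_eq_zero_of_isTrim hmet hX, k.kernel_eq_zero_of_isTrim hmet hX,
      k.kernel_eq_zero_of_isTrim hmet hX]
    ring
  have hinj : Function.Injective k.base := fun x y hxy => by
    by_contra hne
    have := hmet x y hne
    rw [← hd, hxy, dist_self] at this
    exact lt_irrefl _ this
  exact ⟨⟨Equiv.ofBijective k.base ⟨hinj, k.base_surjective⟩, Isometry.of_dist_eq hd⟩⟩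

end

/-! ### Trimming a space with a kernel over a trim base. -/

section trimming

variable {B : Type v} [MetricSpace B]

/-- Over base points `b, c` with `πx` between them, choose `y, z`: all mixed kernels vanish and so
does the base term, leaving `d(x,y,z) = k(x,x)`. -/
theorem gap_le_kernel_self {X : FinPMet.{u}} (k : ForestKernel X B)
    (hB : ∀ a : B, ∃ b c : B, Between a b c) (x : X) : gap X x ≤ k.kernel x x := by
  obtain ⟨b, c, hab, hac, hbc, h⟩ := hB (k.base x)
  obtain ⟨y, rfl⟩ := k.base_surjective b
  obtain ⟨z, rfl⟩ := k.base_surjective c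
  have := gap_le X x y z (fun e => hab (e ▸ rfl)) (fun e => hac (e ▸ rfl)) fun e => hbc (e ▸ rfl)
  rw [k.tripleDist_eq, k.eq_zero _ _ hab, k.eq_zero _ _ hac, k.eq_zero _ _ hbc] at this
  unfold tripleDist at this
  linarith

theorem gap_add_kernel_le {X : FinPMet.{u}} (k : ForestKernel X B)
    (hB : ∀ a : B, ∃ b c : B, Between a b c) (x y : X) (hyx : y ≠ x) :
    gap X x + k.kernel x y ≤ k.kernel x x := by
  by_cases hb : k.base x = k.base y
  -- A third point `z` in another fibre gives `d(x,y,z) = k(x,x) - k(x,y)`.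
  · obtain ⟨c, -, hc, -⟩ := hB (k.base x)
    obtain ⟨z, rfl⟩ := k.base_surjective c
    have h := gap_le X x y z hyx (fun e => hc (e ▸ rfl)) fun e => hc (e ▸ hb)
    rw [k.tripleDist_eq, k.eq_zero _ _ hc, k.eq_zero y z (hb ▸ hc), tripleDist, hb,
      dist_self] at h
    linarith
  · rw [k.eq_zero _ _ hb, add_zero]
    exact k.gap_le_kernel_self hB x

open Classical in
/-- The kernel of `X` after trimming, as a function on the points of `X`. -/
noncomputable def trimKernel {X : FinPMet.{u}} (k : ForestKernel X B) (x y : X) : ℝ :=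
  if x = y then k.kernel x x - gap X x else k.kernel x y

variable {X : FinPMet.{u}} (k : ForestKernel X B)

theorem trimKernel_self (x : X) : k.trimKernel x x = k.kernel x x - gap X x := if_pos rfl

theorem trimKernel_of_ne {x y : X} (h : x ≠ y) : k.trimKernel x y = k.kernel x y := if_neg h

theorem trimKernel_le_self (hB : ∀ a : B, ∃ b c : B, Between a b c) (x y : X) :
    k.trimKernel x y ≤ k.trimKernel x x := by
  by_cases h : x = y
  · rw [h]
  · rw [k.trimKernel_of_ne h, k.trimKernel_self]
    linarith [k.gap_add_kernel_le hB x y (Ne.symm h)]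

theorem trimKernel_comm (x y : X) : k.trimKernel x y = k.trimKernel y x := by
  by_cases h : x = y
  · rw [h]
  · rw [k.trimKernel_of_ne h, k.trimKernel_of_ne (Ne.symm h), k.comm]

theorem trimKernel_nonneg (hB : ∀ a : B, ∃ b c : B, Between a b c) (x y : X) :
    0 ≤ k.trimKernel x y := by
  by_cases h : x = y
  · rw [h, trimKernel_self]
    linarith [k.gap_le_kernel_self hB y]
  · rw [k.trimKernel_of_ne h]
    exact k.nonneg x y

theorem min_trimKernel_le (hB : ∀ a : B, ∃ b c : B, Between a b c) (x y z : X) :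
    min (k.trimKernel x z) (k.trimKernel z y) ≤ k.trimKernel x y := by
  by_cases hxz : x = z
  · subst hxz
    exact min_le_right _ _
  by_cases hzy : z = y
  · subst hzy
    exact min_le_left _ _
  -- Only here, with `x = y ≠ z`, does the lowered diagonal stand on the larger side.
  by_cases hxy : x = y
  · subst hxy
    exact (min_le_left _ _).trans (k.trimKernel_le_self hB x z)
  · rw [k.trimKernel_of_ne hxz, k.trimKernel_of_ne hzy, k.trimKernel_of_ne hxy]
    exact k.ultra x y z

theorem bulletDist_eq (x y : X) :
    bulletDist X x y = k.trimKernel x x + k.trimKernel y y - 2 * k.trimKernel x y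
      + dist (k.base x) (k.base y) := by
  by_cases h : x = y
  · subst h
    simp [bulletDist]
    ring
  · rw [bulletDist, if_neg h, k.trimKernel_self, k.trimKernel_self, k.trimKernel_of_ne h,
      k.dist_eq]
    ring

/-- In the formula for `d^•` the kernel part is non-negative, so distance 0 forces base distance 0.
-/
theorem base_eq_of_proj_eq (hB : ∀ a : B, ∃ b c : B, Between a b c) {x y : X}
    (h : proj X x = proj X y) : k.base x = k.base y := by
  have h0 : bulletDist X x y = 0 := by rw [← dist_proj, h, dist_self]
  rw [k.bulletDist_eq] at h0
  have h1 := k.trimKernel_le_self hB x y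
  have h2 := k.trimKernel_le_self hB y x
  rw [k.trimKernel_comm y x] at h2
  exact dist_le_zero.1 (by linarith)

/-- A forest kernel with trim base of more than one point descends to the trimming. -/
noncomputable def trimming
    (hB : ∀ a : B, ∃ b c : B, Between a b c) : ForestKernel (TrimCore.trimming X) B where
  base a := k.base (Function.surjInv (proj_surjective X) a)
  kernel a b := k.trimKernel (Function.surjInv (proj_surjective X) a)
    (Function.surjInv (proj_surjective X) b)
  -- The one field that needs the base map to be constant on identified points; the others hold for
  -- any choice of representatives.
  base_surjective b := by
    obtain ⟨x, rfl⟩ := k.base_surjective b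
    exact ⟨proj X x, k.base_eq_of_proj_eq hB (Function.surjInv_eq _ _)⟩
  nonneg _ _ := k.trimKernel_nonneg hB _ _
  comm _ _ := k.trimKernel_comm _ _
  ultra _ _ _ := k.min_trimKernel_le hB _ _ _
  eq_zero a b h := by
    rw [k.trimKernel_of_ne (ne_of_apply_ne k.base h), k.eq_zero _ _ h]
  dist_eq a b := by
    rw [← k.bulletDist_eq, ← dist_proj, Function.surjInv_eq (proj_surjective X),
      Function.surjInv_eq (proj_surjective X)]

end trimming

end ForestKernel

theorem trimCore_isMetric (X : FinPMet.{u}) : IsMetric (trimCore X) := by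
  classical
  exact (Nat.find_spec (exists_height X)).1

theorem trimCore_isTrim (X : FinPMet.{u}) : IsTrim (trimCore X) := by
  classical
  exact (Nat.find_spec (exists_height X)).2

theorem trimCore_induction {P : FinPMet.{u} → Prop} (hP : ∀ X, P X → P (trimming X))
    {X : FinPMet.{u}} (hX : P X) : P (trimCore X) :=
  Function.Iterate.rec P hX hP _

theorem trimCore_isometryEquiv_of_between {X : FinPMet.{u}} {B : Type v} [MetricSpace B]
    [Nontrivial B] (hB : ∀ a : B, ∃ b c : B, Between a b c) (k : ForestKernel X B) :
    Nonempty (trimCore X ≃ᵢ B) := by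
  obtain ⟨k'⟩ : Nonempty (ForestKernel (trimCore X) B) :=
    trimCore_induction (P := fun X => Nonempty (ForestKernel X B))
      (fun X ⟨k⟩ => ⟨k.trimming hB⟩) ⟨k⟩
  rcases trimCore_isTrim X with h | h
  · exact absurd k'.base_surjective.subsingleton (not_subsingleton B)
  · exact k'.nonempty_isometryEquiv (trimCore_isMetric X) h

/-! ### Bases with at most one point. -/

/-- The four-point condition, which characterizes tree metrics. -/
def FourPoint (X : Type u) [PseudoMetricSpace X] : Prop :=
  ∀ x y z t : X, dist x y + dist z t ≤ max (dist x z + dist y t) (dist x t + dist y z)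

theorem ForestKernel.fourPoint {X : Type u} [PseudoMetricSpace X] {B : Type v} [MetricSpace B]
    [Subsingleton B] (k : ForestKernel X B) : FourPoint X := by
  intro x y z t
  have hd (a b : X) : dist a b = k.kernel a a + k.kernel b b - 2 * k.kernel a b := by
    rw [k.dist_eq, Subsingleton.elim (k.base a) (k.base b), dist_self, add_zero]
  simp only [hd, le_max_iff]
  -- The diagonal terms cancel, leaving `k(x,y) + k(z,t) ≥ min (k(x,z) + k(y,t)) (k(x,t) + k(y,z))`.
  have h1 := k.ultra x y z
  have h2 := k.ultra x y t
  have h3 := k.ultra z t x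
  have h4 := k.ultra z t y
  rw [k.comm z x] at h3
  rw [k.comm t y] at h2
  rw [k.comm z y] at h1 h4
  by_contra! h
  rcases min_le_iff.1 h1 with h1 | h1 <;> rcases min_le_iff.1 h2 with h2 | h2 <;>
  rcases min_le_iff.1 h3 with h3 | h3 <;> rcases min_le_iff.1 h4 with h4 | h4 <;> linarith

/-- For four distinct points each of the three sums drops by the same total of four gaps.
Coincidences are separate because `d^•` is 0 on the diagonal; they reduce to the triangle inequality
or to an equality. -/
theorem FourPoint.trimming {X : FinPMet.{u}} (h : FourPoint X) : FourPoint (trimming X) := by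
  intro a b c d
  by_cases hab : a = b
  · subst hab
    have := dist_triangle_left c d a
    rw [dist_self, le_max_iff]
    left
    linarith
  by_cases hcd : c = d
  · subst hcd
    have := dist_triangle_right a b c
    rw [dist_self, le_max_iff]
    left
    linarith
  by_cases hac : a = c
  · subst hac
    rw [le_max_iff, dist_comm b a]
    right
    linarith
  by_cases hbd : b = d
  · subst hbd
    rw [le_max_iff, dist_comm b c]
    right
    linarith
  by_cases had : a = d
  · subst had
    rw [le_max_iff, dist_comm b a, dist_comm c a]
    left
    linarith
  by_cases hbc : b = c
  · subst hbc
    rw [le_max_iff]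
    left
    linarith
  obtain ⟨x, rfl⟩ := proj_surjective X a
  obtain ⟨y, rfl⟩ := proj_surjective X b
  obtain ⟨z, rfl⟩ := proj_surjective X c
  obtain ⟨t, rfl⟩ := proj_surjective X d
  have hne {p q : X} (h : proj X p ≠ proj X q) :
      dist (proj X p) (proj X q) = dist p q - gap X p - gap X q := by
    rw [dist_proj, bulletDist, if_neg (ne_of_apply_ne (proj X) h)]
  rw [hne hab, hne hcd, hne hac, hne hbd, hne had, hne hbc]
  have := h x y z t
  rw [le_max_iff] at this ⊢
  rcases this with h | h
  · left
    linarith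
  · right
    linarith

/-- Let `x, y` be at maximal distance and `x` between `u` and `v`. The four-point condition makes
`d(y,u)` or `d(y,v)` exceed `d(x,y)`. -/
theorem FourPoint.subsingleton_of_isTrim {X : Type u} [PseudoMetricSpace X] [Finite X]
    (h : FourPoint X) (hmet : IsMetric X) (htrim : IsTrim X) : Subsingleton X := by
  rcases htrim with hs | htrim
  · exact hs
  by_contra hns
  obtain ⟨⟨x, y⟩, hmax⟩ : ∃ p : X × X, ∀ q : X × X, dist q.1 q.2 ≤ dist p.1 p.2 := by
    have : Nonempty X := not_isEmpty_iff.1 fun _ => hns inferInstance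
    exact Finite.exists_max fun p : X × X => dist p.1 p.2
  obtain ⟨u, v, hxu, hxv, -, huv⟩ := htrim x
  have hu := hmet x u hxu
  have hv := hmet x v hxv
  have h1 := hmax (y, u)
  have h2 := hmax (y, v)
  rcases le_max_iff.1 (h x y u v) with h | h <;> simp only at h1 h2 <;> linarith

theorem trimCore_isometryEquiv_of_subsingleton {X : FinPMet.{u}} {B : Type v} [MetricSpace B]
    [Subsingleton B] (k : ForestKernel X B) : Nonempty (trimCore X ≃ᵢ B) := by
  have hsub : Subsingleton (trimCore X) :=
    FourPoint.subsingleton_of_isTrim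
      (trimCore_induction (P := fun X => FourPoint X) (fun X h => FourPoint.trimming h)
        k.fourPoint)
      (trimCore_isMetric X) (trimCore_isTrim X)
  -- `B` may be empty, so nonemptiness is carried through the trimmings separately.
  have hiff : Nonempty (trimCore X) ↔ Nonempty B := by
    rw [trimCore_induction (P := fun Y => Nonempty Y ↔ Nonempty X)
      (fun Y h => Iff.trans ⟨fun ⟨a⟩ => ⟨(proj_surjective Y a).choose⟩, fun ⟨x⟩ => ⟨proj Y x⟩⟩ h)
      Iff.rfl]
    exact ⟨fun h => h.map k.base, fun ⟨b⟩ => ⟨(k.base_surjective b).choose⟩⟩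
  rcases isEmpty_or_nonempty B with hB | hB
  · have : IsEmpty (trimCore X) := not_nonempty_iff.1 fun h => not_nonempty_iff.2 hB (hiff.1 h)
    exact ⟨⟨Equiv.equivOfIsEmpty _ _, Isometry.of_dist_eq fun x => isEmptyElim x⟩⟩
  · obtain ⟨x⟩ := hiff.2 hB
    obtain ⟨b⟩ := hB
    refine ⟨⟨⟨fun _ => b, fun _ => x, fun _ => Subsingleton.elim _ _,
      fun _ => Subsingleton.elim _ _⟩, Isometry.of_dist_eq fun p q => ?_⟩⟩
    rw [Subsingleton.elim p q, dist_self, dist_self]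

end TrimCore

theorem corollary1p4 (X : Type u) [PseudoMetricSpace X] [Finite X]
    (B : Type v) [MetricSpace B] [Finite B] (hB : TrimCore.IsTrim B)
    (hXB : TrimCore.Dominates.{u, v, w} X B) :
    Nonempty (TrimCore.trimCore (TrimCore.FinPMet.mk X) ≃ᵢ B) := by
  obtain ⟨k⟩ := hXB.nonempty_forestKernel
  rcases subsingleton_or_nontrivial B with h | h
  · exact TrimCore.trimCore_isometryEquiv_of_subsingleton (X := TrimCore.FinPMet.mk X) k
  · exact TrimCore.trimCore_isometryEquiv_of_between (X := TrimCore.FinPMet.mk X)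
      (hB.resolve_left (not_subsingleton B)) k
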